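/- Let $G=(V,E)$ be a finite simple graph and $S\subseteq V$. Put one qubit on each vertex and let $X_i, Z_i$ denote the Pauli matrices $X,Z$ acting on qubit $i$ (and as the identity on all other qubits) of $(\mathbb{C}^2)^{\otimes V}$. Let $\gamma$, $\omega$ and $\omega_i$ ($i\in S$) be real numbers that are linearly independent over $\mathbb{Q}$, and let $$H_Z=\gamma\sum_{\{i,j\}\in E} Z_iZ_j+\sum_{i\in S}\omega_i Z_i+\omega\sum_{i\in V\setminus S} Z_i,\qquad H_X=\sum_{i\in V}X_i .$$ Let $\mathcal{L}=\langle iH_Z,iH_X\rangle_{\mathrm{Lie}}$ be the smallest real Lie algebra of matrices (with the commutator bracket) that contains $iH_Z$ and $iH_X$. Suppose that $S$ is a zero forcing set of $G$: starting with exactly the vertices of $S$ infected, one can infect all of $V$ by finitely many steps in each of which an infected vertex $v$ infects a non-infected neighbour $w$ that is the only non-infected neighbour of $v$. Then 1. $iZ_kZ_j\in\mathcal{L}$ for every edge $\{k,j\}\in E$; 2. $iX_k\in\mathcal{L}$ for every vertex $k\in V$; 3. if $G$ is connected, the pair $(H_Z,H_X)$ is universal: for every unitary $U$ on $(\mathbb{C}^2)^{\otimes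 V}$ and every $\varepsilon>0$ there are $p\ge 1$, angles $\gamma_1,\dots,\gamma_p,\beta_1,\dots,\beta_p\in[0,2\pi]$ and $\theta\in\mathbb{R}$ with $$\bigl\|U-e^{i\theta}\,e^{-i\beta_pH_X}e^{-i\gamma_pH_Z}\cdots e^{-i\beta_1H_X}e^{-i\gamma_1H_Z}\bigr\|\le\varepsilon$$ in operator norm. -/

import Mathlib

attribute [local instance 100] LieRing.ofAssociativeRing

namespace QAOA

/-- The operators on the Hilbert space `⨂_{v ∈ V} ℂ²` of one qubit per element of `V`, as complex
matrices in the computational basis, which is indexed by the bit strings `V → Fin 2`. -/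
abbrev Op (V : Type*) : Type _ := Matrix (V → Fin 2) (V → Fin 2) ℂ

/-- The Pauli matrix `X`. -/
def pauliX : Matrix (Fin 2) (Fin 2) ℂ := !![0, 1; 1, 0]

/-- The Pauli matrix `Z`. -/
def pauliZ : Matrix (Fin 2) (Fin 2) ℂ := !![1, 0; 0, -1]

/-- The tensor (Kronecker) product `⨂_v A v` of one-qubit operators. -/
def tensor {V : Type*} [Fintype V] (A : V → Matrix (Fin 2) (Fin 2) ℂ) : Op V :=
  Matrix.of fun a b => ∏ v, A v (a v) (b v)

/-- The one-qubit operator `A` acting on the qubit `i`, the identity on every other qubit. -/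
def onQubit {V : Type*} [Fintype V] [DecidableEq V] (i : V) (A : Matrix (Fin 2) (Fin 2) ℂ) :
    Op V :=
  tensor (Pi.mulSingle i A)

/-- `X_i`. -/
def X {V : Type*} [Fintype V] [DecidableEq V] (i : V) : Op V := onQubit i pauliX

/-- `Z_i`. -/
def Z {V : Type*} [Fintype V] [DecidableEq V] (i : V) : Op V := onQubit i pauliZ

theorem tensor_mul {V : Type*} [Fintype V] [DecidableEq V]
    (A B : V → Matrix (Fin 2) (Fin 2) ℂ) : tensor A * tensor B = tensor (A * B) := by
  ext a b
  simp only [tensor, Matrix.mul_apply, Matrix.of_apply, Pi.mul_apply, ← Finset.prod_mul_distrib]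
  rw [Finset.prod_univ_sum]
  simp

theorem Z_mul_comm {V : Type*} [Fintype V] [DecidableEq V] (i j : V) :
    (Z i : Op V) * Z j = Z j * Z i := by
  simp only [Z, onQubit, tensor_mul]
  congr 1
  rcases eq_or_ne i j with rfl | h
  · rfl
  · exact Pi.mulSingle_commute (f := fun _ : V => Matrix (Fin 2) (Fin 2) ℂ) h pauliZ pauliZ

/-- The edge term `Z_i Z_j` of the unordered pair `{i, j}`. -/
noncomputable def edgeZZ {V : Type*} [Fintype V] [DecidableEq V] : Sym2 V → Op V :=
  Sym2.lift ⟨fun i j => Z i * Z j, Z_mul_comm⟩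

/-- `H_Z = γ ∑_{{i,j} ∈ E} Z_i Z_j + ∑_{i ∈ S} ω_i Z_i + ω ∑_{i ∈ V ∖ S} Z_i`. -/
noncomputable def costHamiltonian {V : Type*} [Fintype V] [DecidableEq V] (G : SimpleGraph V)
    [DecidableRel G.Adj] (S : Finset V) (γ : ℝ) (ωS : S → ℝ) (ω : ℝ) : Op V :=
  γ • (∑ e ∈ G.edgeFinset, edgeZZ e) + (∑ i : S, ωS i • Z (i : V)) + ω • (∑ i ∈ Sᶜ, Z i)

/-- `H_X = ∑_{i ∈ V} X_i`. -/
noncomputable def mixerHamiltonian (V : Type*) [Fintype V] [DecidableEq V] : Op V := ∑ i : V, X i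

/-- The real Lie algebra `⟨i H_Z, i H_X⟩_Lie`, with the commutator as its bracket. -/
noncomputable def generatedLieAlgebra {V : Type*} [Fintype V] [DecidableEq V] (HZ HX : Op V) :
    LieSubalgebra ℝ (Op V) :=
  LieSubalgebra.lieSpan ℝ (Op V) {Complex.I • HZ, Complex.I • HX}

/-- One step of the zero forcing process takes the infected set `A` to `B`: an infected vertex `v`
infects `w`, its only non-infected neighbour. -/
def ForcingStep {V : Type*} [DecidableEq V] (G : SimpleGraph V) (A B : Finset V) : Prop :=
  ∃ v ∈ A, ∃ w ∉ A, G.Adj v w ∧ (∀ u ∉ A, G.Adj v u → u = w) ∧ B = insert w A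

/-- `S` is a zero forcing set: finitely many steps starting at `S` can infect every vertex. -/
def IsZeroForcingSet {V : Type*} [Fintype V] [DecidableEq V] (G : SimpleGraph V)
    (S : Finset V) : Prop :=
  Relation.ReflTransGen (ForcingStep G) S Finset.univ

/-- `U(H, α) = e^{-iαH}`. -/
noncomputable def evolution {V : Type*} [Fintype V] [DecidableEq V] (H : Op V) (α : ℝ) : Op V :=
  NormedSpace.exp ((-(Complex.I * (α : ℂ))) • H)

/-- The circuits `U(H_X, β_p) U(H_Z, γ_p) ⋯ U(H_X, β_1) U(H_Z, γ_1)` of length `p` with all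
angles in `[0, 2π]`. -/
def circuitsOfLength {V : Type*} [Fintype V] [DecidableEq V] (HZ HX : Op V) (p : ℕ) :
    Set (Op V) :=
  {W | ∃ γ β : Fin p → ℝ,
    (∀ j, γ j ∈ Set.Icc 0 (2 * Real.pi) ∧ β j ∈ Set.Icc 0 (2 * Real.pi)) ∧
    W = (List.ofFn fun j : Fin p => evolution HX (β j) * evolution HZ (γ j)).reverse.prod}

/-- All circuits, of every length `p ≥ 1`. -/
def circuits {V : Type*} [Fintype V] [DecidableEq V] (HZ HX : Op V) : Set (Op V) :=
  ⋃ p : ℕ, ⋃ _ : 1 ≤ p, circuitsOfLength HZ HX p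

/-- Universality: up to a phase, every unitary is approximated in operator norm to arbitrary
precision by a circuit. -/
def IsUniversal {V : Type*} [Fintype V] [DecidableEq V] (HZ HX : Op V) : Prop :=
  ∀ U ∈ Matrix.unitaryGroup (V → Fin 2) ℂ, ∀ ε : ℝ, 0 < ε →
    ∃ W ∈ circuits HZ HX, ∃ θ : ℝ,
      ‖Matrix.toEuclideanCLM (n := V → Fin 2) (𝕜 := ℂ)
        (U - Complex.exp (Complex.I * (θ : ℂ)) • W)‖ ≤ ε

end QAOA

/-! Bracketing with `i H_Z`, which is diagonal, multiplies the entry at `(a, b)` by `i` times the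
energy difference. Iterated brackets and interpolation therefore multiply entries by any even real
function of that difference, or by `i` times any odd one. The entries of `X i` join bit strings that
differ only at `i`, where the difference is `± 2 (τ + γ m)` with `τ` the field at `i` and `m` an
integer. Rational independence makes both `τ` and the sign readable from this number, so `i H_X`
splits according to the fields: `sum_X_mem` and `sum_Z_mem` give `X j`, `Z j` for each `j ∈ S` and
the sums of `X i` and of `Z i` over `Sᶜ`.

Subtracting the field terms from `H_Z` leaves the sum of all edge terms. Conjugation by an
involution isolates the summands anticommuting with it, and `forcingStep_mem` uses this to follow a
forcing step: the edge term `Z v * Z w`, then `X w`, then `Z w`.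

For connected `G`, commutators of one- and two-qubit Pauli operators produce every nonidentity Pauli
string. The global phase supplies the identity, so all skew-Hermitian matrices are reached. The
closure of the phased circuits is a closed submonoid of the unitary group, hence a group, and its
Lie algebra contains the generators. It is thus everything, and every unitary is `exp (i a)` with
`a` self-adjoint. -/

namespace QAOA

/-! ### Hermitian elements of a matrix Lie algebra and conjugation by involutions -/

section HermitianPart

variable {n : Type*} [Fintype n] [DecidableEq n]

/-- The matrices `A` such that `i A` lies in the real Lie algebra `L`. -/
def observables (L : LieSubalgebra ℝ (Matrix n n ℂ)) : Submodule ℝ (Matrix n n ℂ) where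
  carrier := {A | Complex.I • A ∈ L}
  add_mem' {A B} hA hB := by
    simp only [Set.mem_ofPred_eq, smul_add] at *
    exact L.add_mem hA hB
  zero_mem' := by simp
  smul_mem' r A hA := by
    simp only [Set.mem_ofPred_eq] at *
    rw [smul_comm]
    exact L.smul_mem r hA

variable {L : LieSubalgebra ℝ (Matrix n n ℂ)} {A B : Matrix n n ℂ}

theorem mem_observables : A ∈ observables L ↔ Complex.I • A ∈ L := Iff.rfl

theorem commutator_mem (hA : A ∈ observables L) (hB : B ∈ observables L) : A * B - B * A ∈ L := by
  have h : A * B - B * A = -⁅Complex.I • A, Complex.I • B⁆ := by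
    simp only [Ring.lie_def, smul_mul_smul_comm, Complex.I_mul_I]
    module
  exact h ▸ L.neg_mem (L.lie_mem hA hB)

theorem I_smul_commutator_mem (hA : A ∈ observables L) (hB : B ∈ observables L) :
    Complex.I • (A * B - B * A) ∈ observables L := by
  rw [mem_observables, smul_smul, Complex.I_mul_I, neg_one_smul]
  exact L.neg_mem (commutator_mem hA hB)

/-- For an involution `A` the double commutator `[A, [A, B]]` equals `2 (B - A B A)`. -/
theorem sub_conj_mem (hA : A ∈ observables L) (hA2 : A * A = 1) (hB : B ∈ observables L) :
    B - A * B * A ∈ observables L := by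
  have h1 := L.lie_mem hA (commutator_mem hA hB)
  have h2 := (observables L).smul_mem (2⁻¹ : ℝ) (mem_observables.2
    (show Complex.I • (A * (A * B - B * A) - (A * B - B * A) * A) ∈ L by
      convert h1 using 1
      simp only [Ring.lie_def, smul_mul_assoc, mul_smul_comm, smul_sub]))
  convert h2 using 1
  have : A * (A * B - B * A) - (A * B - B * A) * A = (2 : ℝ) • (B - A * B * A) := by
    rw [mul_sub, sub_mul, ← mul_assoc, hA2, one_mul, mul_assoc B A A, hA2, mul_one, ← mul_assoc]
    module
  rw [this, smul_smul]
  norm_num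

/-- Conjugation by an involution `A` separates the summands that anticommute with `A` from those
that commute with it. -/
theorem sum_filter_mem {ι : Type*} {s : Finset ι} {f : ι → Matrix n n ℂ} {p : ι → Prop}
    [DecidablePred p] (hA : A ∈ observables L) (hA2 : A * A = 1)
    (hf : ∑ e ∈ s, f e ∈ observables L)
    (hp : ∀ e ∈ s, p e → A * f e = -(f e * A)) (hn : ∀ e ∈ s, ¬ p e → A * f e = f e * A) :
    ∑ e ∈ s with p e, f e ∈ observables L := by
  have h := (observables L).smul_mem (2⁻¹ : ℝ) (sub_conj_mem hA hA2 hf)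
  convert h using 1
  rw [Finset.mul_sum, Finset.sum_mul, ← Finset.sum_sub_distrib, Finset.smul_sum,
    Finset.sum_filter]
  refine Finset.sum_congr rfl fun e he => ?_
  split_ifs with h'
  · rw [hp e he h', neg_mul, mul_assoc, hA2, mul_one]
    module
  · rw [hn e he h', mul_assoc, hA2, mul_one, sub_self, smul_zero]

end HermitianPart

/-! ### Pauli matrix relations, with labels read modulo 3 -/

section Pauli

/-- The Pauli matrices `X`, `Y`, `Z`. -/
def pauli : Fin 3 → Matrix (Fin 2) (Fin 2) ℂ :=
  ![pauliX, !![0, -Complex.I; Complex.I, 0], pauliZ]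

theorem pauli_mul_self (c : Fin 3) : pauli c * pauli c = 1 := by
  fin_cases c <;> ext a b <;> fin_cases a <;> fin_cases b <;>
    simp [pauli, pauliX, pauliZ, Matrix.mul_apply]

theorem pauli_mul_succ (c : Fin 3) : pauli (c + 1) * pauli (c + 2) = Complex.I • pauli c := by
  fin_cases c <;> ext a b <;> fin_cases a <;> fin_cases b <;>
    simp [pauli, pauliX, pauliZ, Matrix.mul_apply]

theorem pauli_succ_mul (c : Fin 3) : pauli (c + 2) * pauli (c + 1) = -(Complex.I • pauli c) := by
  fin_cases c <;> ext a b <;> fin_cases a <;> fin_cases b <;>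
    simp [pauli, pauliX, pauliZ, Matrix.mul_apply]

theorem pauli_isHermitian (c : Fin 3) : (pauli c).IsHermitian := by
  fin_cases c <;> ext a b <;> fin_cases a <;> fin_cases b <;>
    simp [pauli, pauliX, pauliZ, Matrix.conjTranspose_apply]

theorem pauliX_mul_pauliZ : pauliX * pauliZ = -(pauliZ * pauliX) := by
  ext a b; fin_cases a <;> fin_cases b <;> simp [pauliX, pauliZ, Matrix.mul_apply]

end Pauli

/-! ### Tensor products of one-qubit operators and their commutation rules -/

section Tensor

theorem tensor_isHermitian {V : Type*} [Fintype V] {A : V → Matrix (Fin 2) (Fin 2) ℂ} (hA : ∀ v, (A v).IsHermitian) :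
    (tensor A).IsHermitian := by
  ext a b
  simp only [tensor, Matrix.conjTranspose_apply, Matrix.of_apply, star_prod]
  exact Finset.prod_congr rfl fun v _ => (hA v).apply _ _

variable {V : Type*} [Fintype V] [DecidableEq V]

theorem tensor_one : tensor (1 : V → Matrix (Fin 2) (Fin 2) ℂ) = 1 := by
  ext a b
  simp only [tensor, Matrix.of_apply, Pi.one_apply, Matrix.one_apply, Finset.prod_ite_zero,
    Finset.prod_const_one]
  simp [funext_iff]

theorem tensor_update_add (A : V → Matrix (Fin 2) (Fin 2) ℂ) (k : V)
    (B C : Matrix (Fin 2) (Fin 2) ℂ) :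
    tensor (Function.update A k (B + C)) =
      tensor (Function.update A k B) + tensor (Function.update A k C) := by
  ext a b
  simp only [tensor, Matrix.of_apply, Matrix.add_apply]
  have h (D : Matrix (Fin 2) (Fin 2) ℂ) (v : V) : Function.update A k D v (a v) (b v) =
      Function.update (fun v => A v (a v) (b v)) k (D (a k) (b k)) v := by
    by_cases hv : v = k
    · subst hv; simp
    · simp [hv]
  simp only [h, Finset.prod_update_of_mem (Finset.mem_univ k), Matrix.add_apply, add_mul]

theorem tensor_update_smul (A : V → Matrix (Fin 2) (Fin 2) ℂ) (k : V) (c : ℂ)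
    (B : Matrix (Fin 2) (Fin 2) ℂ) :
    tensor (Function.update A k (c • B)) = c • tensor (Function.update A k B) := by
  ext a b
  simp only [tensor, Matrix.of_apply, Matrix.smul_apply]
  have h (D : Matrix (Fin 2) (Fin 2) ℂ) (v : V) : Function.update A k D v (a v) (b v) =
      Function.update (fun v => A v (a v) (b v)) k (D (a k) (b k)) v := by
    by_cases hv : v = k
    · subst hv; simp
    · simp [hv]
  simp only [h, Finset.prod_update_of_mem (Finset.mem_univ k), Matrix.smul_apply, smul_eq_mul,
    mul_assoc]

theorem tensor_update_neg (A : V → Matrix (Fin 2) (Fin 2) ℂ) (k : V)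
    (B : Matrix (Fin 2) (Fin 2) ℂ) :
    tensor (Function.update A k (-B)) = -tensor (Function.update A k B) := by
  rw [← neg_one_smul ℂ B, tensor_update_smul, neg_one_smul]

theorem onQubit_eq_tensor_update (i : V) (A : Matrix (Fin 2) (Fin 2) ℂ) :
    onQubit i A = tensor (Function.update 1 i A) := rfl

theorem onQubit_mul_onQubit (i : V) (A B : Matrix (Fin 2) (Fin 2) ℂ) :
    onQubit i A * onQubit i B = onQubit i (A * B) := by
  simp only [onQubit, tensor_mul, Pi.mulSingle_mul]

theorem onQubit_neg (i : V) (A : Matrix (Fin 2) (Fin 2) ℂ) :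
    onQubit i (-A) = -onQubit i A := by
  simp only [onQubit_eq_tensor_update, tensor_update_neg]

theorem onQubit_one (i : V) : onQubit i 1 = 1 := by
  rw [onQubit, Pi.mulSingle_one, tensor_one]

theorem onQubit_comm {i j : V} (h : i ≠ j) (A B : Matrix (Fin 2) (Fin 2) ℂ) :
    onQubit i A * onQubit j B = onQubit j B * onQubit i A := by
  simp only [onQubit, tensor_mul]
  congr 1
  exact Pi.mulSingle_commute (f := fun _ : V => Matrix (Fin 2) (Fin 2) ℂ) h A B

theorem onQubit_isHermitian (i : V) {A : Matrix (Fin 2) (Fin 2) ℂ} (hA : A.IsHermitian) :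
    (onQubit i A).IsHermitian := by
  refine tensor_isHermitian fun v => ?_
  by_cases hv : v = i
  · subst hv; simpa using hA
  · simp [hv]

theorem X_eq (i : V) : X i = onQubit i (pauli 0) := rfl

theorem Z_eq (i : V) : Z i = onQubit i (pauli 2) := rfl

theorem pauli_two : pauli 2 = pauliZ := rfl

theorem X_mul_self (i : V) : (X i : Op V) * X i = 1 := by
  rw [X_eq, onQubit_mul_onQubit, pauli_mul_self, onQubit_one]

theorem Z_mul_self (i : V) : (Z i : Op V) * Z i = 1 := by
  rw [Z_eq, onQubit_mul_onQubit, pauli_mul_self, onQubit_one]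

theorem X_mul_Z_self (i : V) : (X i : Op V) * Z i = -(Z i * X i) := by
  rw [X, Z, onQubit_mul_onQubit, onQubit_mul_onQubit, pauliX_mul_pauliZ, onQubit_neg]

theorem X_mul_Z_comm {i j : V} (h : i ≠ j) : (X i : Op V) * Z j = Z j * X i :=
  onQubit_comm h _ _

theorem X_mul_edgeZZ_of_mem {v : V} {e : Sym2 V} (he : ¬ e.IsDiag) (hv : v ∈ e) :
    X v * edgeZZ e = -(edgeZZ e * X v) := by
  obtain ⟨u, rfl⟩ := hv
  have hu : v ≠ u := by simpa using he
  change X v * (Z v * Z u) = -(Z v * Z u * X v)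
  rw [← mul_assoc, X_mul_Z_self, mul_assoc (Z v) (Z u), ← X_mul_Z_comm hu, neg_mul, mul_assoc]

theorem X_mul_edgeZZ_of_notMem {v : V} {e : Sym2 V} (hv : v ∉ e) :
    X v * edgeZZ e = edgeZZ e * X v := by
  induction e using Sym2.ind with
  | _ a b =>
    simp only [Sym2.mem_iff, not_or] at hv
    change X v * (Z a * Z b) = Z a * Z b * X v
    rw [← mul_assoc, X_mul_Z_comm hv.1, mul_assoc, X_mul_Z_comm hv.2, mul_assoc]

theorem edgeZZ_mul_self (e : Sym2 V) : edgeZZ e * edgeZZ e = 1 := by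
  induction e using Sym2.ind with
  | _ a b =>
    change Z a * Z b * (Z a * Z b) = 1
    rw [mul_assoc, ← mul_assoc (Z b), Z_mul_comm b a, mul_assoc (Z a), Z_mul_self, mul_one,
      Z_mul_self]

end Tensor

/-! ### Functional calculus for the bracket with a diagonal matrix -/

section Spectral

variable {n : Type*} [Fintype n] [DecidableEq n] {L : LieSubalgebra ℝ (Matrix n n ℂ)} {h : n → ℝ}
  {M : Matrix n n ℂ}

theorem lie_diagonal (h : n → ℝ) (M : Matrix n n ℂ) :
    ⁅Complex.I • Matrix.diagonal (fun a => (h a : ℂ)), M⁆ =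
      Matrix.of fun a b => Complex.I * ((h a - h b : ℝ) : ℂ) * M a b := by
  ext a b
  simp only [Ring.lie_def, Matrix.sub_apply, smul_mul_assoc, mul_smul_comm, Matrix.smul_apply,
    Matrix.diagonal_mul, Matrix.mul_diagonal, smul_eq_mul, Matrix.of_apply]
  push_cast
  ring

/-- A Lie algebra containing `i diag(h)` is closed under entrywise multiplication with even real
functions of `h a - h b`. -/
theorem of_even_mul_mem (hL : Complex.I • Matrix.diagonal (fun a => (h a : ℂ)) ∈ L) (hM : M ∈ L)
    {f : ℝ → ℝ} (hf : ∀ t, f (-t) = f t) :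
    (Matrix.of fun a b => (f (h a - h b) : ℂ) * M a b) ∈ L := by
  -- Two brackets with `i diag(h)` multiply the entry at `(a, b)` by `-(h a - h b) ^ 2`, so
  -- polynomials in this quantity are available.
  have key (p : Polynomial ℝ) :
      (Matrix.of fun a b => ((p.eval (-(h a - h b) ^ 2) : ℝ) : ℂ) * M a b) ∈ L := by
    induction p using Polynomial.induction_on with
    | C r =>
      convert L.smul_mem r hM using 1
      ext a b
      simp
    | add p q hp hq =>
      convert L.add_mem hp hq using 1
      ext a b
      simp [add_mul]
    | monomial k r ih =>
      have h2 := L.lie_mem hL (L.lie_mem hL ih)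
      rw [lie_diagonal, lie_diagonal] at h2
      convert h2 using 1
      ext a b
      simp only [Polynomial.eval_mul, Polynomial.eval_C, Polynomial.eval_pow, Polynomial.eval_X,
        Matrix.of_apply, ← mul_assoc]
      congr 1
      push_cast
      linear_combination (-(h a - h b : ℂ) ^ 2 * r * (-(h a - h b : ℂ) ^ 2) ^ k) * Complex.I_sq
  classical
  -- Only finitely many differences occur, so interpolation suffices. Evenness lets `f` be recovered
  -- from the square of its argument.
  obtain ⟨p, hp⟩ : ∃ p : Polynomial ℝ, ∀ a b, p.eval (-(h a - h b) ^ 2) = f (h a - h b) := by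
    refine ⟨Lagrange.interpolate
      (Finset.univ.image fun x : n × n => -(h x.1 - h x.2) ^ 2) id fun t => f (√(-t)),
      fun a b => ?_⟩
    refine (Lagrange.eval_interpolate_at_node (v := id) _ (Set.injOn_id _)
      (Finset.mem_image_of_mem (fun x : n × n => -(h x.1 - h x.2) ^ 2)
        (Finset.mem_univ (a, b)))).trans ?_
    rw [neg_neg, Real.sqrt_sq_eq_abs]
    rcases abs_choice (h a - h b) with h' | h' <;> simp [h', hf, -neg_sub]
  simpa only [hp] using key p

theorem of_odd_mul_mem (hL : Complex.I • Matrix.diagonal (fun a => (h a : ℂ)) ∈ L) (hM : M ∈ L)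
    {g : ℝ → ℝ} (hg : ∀ t, g (-t) = -g t) :
    (Matrix.of fun a b => Complex.I * (g (h a - h b) : ℂ) * M a b) ∈ L := by
  have h0 : g 0 = 0 := by
    have := hg 0
    rw [neg_zero] at this
    linarith
  have h1 := L.lie_mem hL hM
  rw [lie_diagonal] at h1
  -- One bracket contributes `i t`, and `g t / t` is even. At `t = 0` both sides vanish because `g 0
  -- = 0`.
  convert of_even_mul_mem hL h1 (f := fun t => g t / t)
    (fun t => by rw [hg, neg_div_neg_eq]) using 1
  ext a b
  simp only [Matrix.of_apply, ← mul_assoc]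
  congr 1
  rcases eq_or_ne (h a - h b) 0 with ht | ht
  · simp [ht, h0]
  · rw [mul_right_comm, ← Complex.ofReal_mul, div_mul_cancel₀ _ ht, mul_comm]

end Spectral

/-! ### Eigenvalues of the cost Hamiltonian and their change under one bit flip -/

section Energy

/-- The eigenvalues `1`, `-1` of `Z`. -/
def spin : Fin 2 → ℤ := ![1, -1]

theorem spin_eq_neg {x y : Fin 2} (h : x ≠ y) : spin y = -spin x := by
  fin_cases x <;> fin_cases y <;> simp_all [spin]

theorem spin_eq_or (x : Fin 2) : spin x = 1 ∨ spin x = -1 := by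
  fin_cases x <;> simp [spin]

variable {V : Type*}

/-- The eigenvalue of `Z_i Z_j` at a bit string. -/
def edgeSpin (a : V → Fin 2) : Sym2 V → ℤ :=
  Sym2.lift ⟨fun i j => spin (a i) * spin (a j), fun _ _ => mul_comm _ _⟩

theorem exists_edgeSpin_sub {a b : V → Fin 2} {i : V} (hab : ∀ v, v ≠ i → a v = b v)
    (hi : a i ≠ b i) {e : Sym2 V} (he : ¬ e.IsDiag) :
    ∃ m : ℤ, edgeSpin a e - edgeSpin b e = 2 * spin (a i) * m := by
  by_cases h : i ∈ e
  · obtain ⟨j, rfl⟩ := h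
    have hj : j ≠ i := by simpa [eq_comm] using he
    refine ⟨spin (a j), ?_⟩
    change spin (a i) * spin (a j) - spin (b i) * spin (b j) = _
    rw [spin_eq_neg hi, ← hab j hj]
    ring
  · refine ⟨0, ?_⟩
    induction e using Sym2.ind with
    | _ u v =>
      simp only [Sym2.mem_iff, not_or] at h
      change spin (a u) * spin (a v) - spin (b u) * spin (b v) = _
      rw [hab u (Ne.symm h.1), hab v (Ne.symm h.2)]
      ring

variable [Fintype V] [DecidableEq V]

theorem onQubit_apply (i : V) (A : Matrix (Fin 2) (Fin 2) ℂ) (a b : V → Fin 2) :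
    onQubit i A a b = if ∀ v, v ≠ i → a v = b v then A (a i) (b i) else 0 := by
  simp only [onQubit, tensor, Matrix.of_apply]
  rw [← Finset.mul_prod_erase Finset.univ _ (Finset.mem_univ i), Pi.mulSingle_eq_same]
  have : ∏ v ∈ Finset.univ.erase i, Pi.mulSingle (M := fun _ => Matrix (Fin 2) (Fin 2) ℂ) i A v
      (a v) (b v) = ∏ v ∈ Finset.univ.erase i, if a v = b v then 1 else 0 :=
    Finset.prod_congr rfl fun v hv => by
      rw [Pi.mulSingle_eq_of_ne (Finset.ne_of_mem_erase hv), Matrix.one_apply]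
  rw [this, Finset.prod_ite_zero]
  simp

theorem Z_eq_diagonal (i : V) : (Z i : Op V) = Matrix.diagonal fun a => (spin (a i) : ℂ) := by
  ext a b
  rw [Z, onQubit_apply, Matrix.diagonal_apply]
  have hz : ∀ x y : Fin 2, pauliZ x y = if x = y then (spin x : ℂ) else 0 := by
    intro x y
    fin_cases x <;> fin_cases y <;> simp [pauliZ, spin]
  by_cases hab : a = b
  · subst hab; simp [hz]
  · rw [if_neg hab, hz]
    split_ifs with h1 h2
    · refine absurd (funext fun v => ?_) hab
      by_cases hv : v = i
      · rw [hv, h2]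
      · exact h1 v hv
    · rfl
    · rfl

theorem edgeZZ_eq_diagonal (e : Sym2 V) :
    edgeZZ e = Matrix.diagonal fun a => (edgeSpin a e : ℂ) := by
  induction e using Sym2.ind with
  | _ i j =>
    change Z i * Z j = Matrix.diagonal fun a => ((spin (a i) * spin (a j) : ℤ) : ℂ)
    simp [Z_eq_diagonal, Matrix.diagonal_mul_diagonal]

variable (G : SimpleGraph V) [DecidableRel G.Adj] (S : Finset V) (γ : ℝ) (ωS : S → ℝ) (ω : ℝ)

/-- The coefficient of `Z_i` in the cost Hamiltonian. -/
def field (i : V) : ℝ := if h : i ∈ S then ωS ⟨i, h⟩ else ω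

theorem costHamiltonian_eq :
    costHamiltonian G S γ ωS ω = γ • (∑ e ∈ G.edgeFinset, edgeZZ e) +
      ∑ i, field S ωS ω i • (Z i : Op V) := by
  rw [costHamiltonian, add_assoc, ← Finset.sum_add_sum_compl S, ← Finset.sum_coe_sort S,
    Finset.smul_sum (s := Sᶜ)]
  congr 2
  · exact Finset.sum_congr rfl fun i _ => by simp [field]
  · refine Finset.sum_congr rfl fun i hi => ?_
    rw [show field S ωS ω i = ω from dif_neg (Finset.mem_compl.1 hi)]

/-- The eigenvalues of the cost Hamiltonian. -/
def energy (a : V → Fin 2) : ℝ :=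
  γ * (∑ e ∈ G.edgeFinset, edgeSpin a e : ℤ) + ∑ i, field S ωS ω i * spin (a i)

theorem costHamiltonian_eq_diagonal :
    costHamiltonian G S γ ωS ω = Matrix.diagonal fun a => (energy G S γ ωS ω a : ℂ) := by
  rw [costHamiltonian_eq]
  ext a b
  by_cases hab : a = b
  · subst hab
    simp [Matrix.sum_apply, Z_eq_diagonal, edgeZZ_eq_diagonal, energy]
  · simp [Matrix.sum_apply, Z_eq_diagonal, edgeZZ_eq_diagonal, hab]

/-- A flip at `i` affects only the field at `i` and the edges through `i`. All that matters later
about the edge contribution is that it is an integer multiple of `2γ`. -/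
theorem exists_energy_sub {a b : V → Fin 2} {i : V} (hab : ∀ v, v ≠ i → a v = b v)
    (hi : a i ≠ b i) :
    ∃ m : ℤ, energy G S γ ωS ω a - energy G S γ ωS ω b =
      spin (a i) * (2 * (field S ωS ω i + γ * m)) := by
  obtain ⟨m, hm⟩ : ∃ m : ℤ, ∑ e ∈ G.edgeFinset, edgeSpin a e - ∑ e ∈ G.edgeFinset, edgeSpin b e =
      2 * spin (a i) * m := by
    rw [← Finset.sum_sub_distrib]
    have h (e : Sym2 V) (he : e ∈ G.edgeFinset) :=
      exists_edgeSpin_sub hab hi (G.not_isDiag_of_mem_edgeFinset he)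
    exact Finset.dvd_sum fun e he => h e he
  have hz : ∑ v, field S ωS ω v * spin (a v) - ∑ v, field S ωS ω v * spin (b v) =
      2 * spin (a i) * field S ωS ω i := by
    rw [← Finset.sum_sub_distrib, Finset.sum_eq_single i]
    · rw [spin_eq_neg hi]
      push_cast
      ring
    · intro v _ hv
      rw [hab v hv, sub_self]
    · simp
  refine ⟨m, ?_⟩
  have hm' := congrArg (Int.cast : ℤ → ℝ) hm
  push_cast at hm'
  simp only [energy]
  push_cast
  linear_combination γ * hm' + hz

end Energy

/-! ### Consequences of rational independence of the coefficients -/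

section Independence

/-- The coefficient at `x` of a vanishing rational combination is read off; the `if` covers `x = y`,
where two terms share an index. With `b = -1` this forces `x = y`, and with `b = 1` it is absurd. -/
theorem coeff_eq_zero_of_linearIndependent {ι : Type*} [DecidableEq ι] {v : ι → ℝ}
    (hv : LinearIndependent ℚ v) {g x y : ι} (hx : x ≠ g) {b : ℚ} {m : ℤ}
    (h : v x + b * v y + v g * m = 0) : 1 + (if x = y then b else 0) = 0 := by
  rw [linearIndependent_iff] at hv
  have := DFunLike.congr_fun (hv (Finsupp.single x 1 + Finsupp.single y b +
    Finsupp.single g (m : ℚ)) (by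
      simp only [map_add, Finsupp.linearCombination_single, Rat.smul_def]
      push_cast
      linarith)) x
  simpa [Finsupp.single_apply, hx.symm, eq_comm] using this

variable {V : Type*} [DecidableEq V] {S : Finset V} {γ : ℝ} {ωS : S → ℝ} {ω : ℝ}

/-- The index of the field at `i` in the family of coefficients. -/
def fieldIndex (S : Finset V) (i : V) : Fin 2 ⊕ S :=
  if h : i ∈ S then Sum.inr ⟨i, h⟩ else Sum.inl 1

theorem elim_fieldIndex (γ : ℝ) (ωS : S → ℝ) (ω : ℝ) (i : V) :
    Sum.elim ![γ, ω] ωS (fieldIndex S i) = field S ωS ω i := by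
  unfold fieldIndex field
  split_ifs <;> rfl

theorem fieldIndex_ne (i : V) : fieldIndex S i ≠ Sum.inl 0 := by
  unfold fieldIndex
  split_ifs <;> simp

theorem fieldIndex_eq_of_field_eq_add
    (hindep : LinearIndependent ℚ (Sum.elim ![γ, ω] ωS : Fin 2 ⊕ S → ℝ))
    {i j : V} {m : ℤ}
    (h : field S ωS ω i = field S ωS ω j + γ * m) : fieldIndex S i = fieldIndex S j := by
  have := coeff_eq_zero_of_linearIndependent hindep (fieldIndex_ne i) (y := fieldIndex S j)
    (b := -1) (m := -m) (g := Sum.inl 0) (by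
      simp only [elim_fieldIndex, Sum.elim_inl, Matrix.cons_val_zero]
      push_cast
      linarith)
  by_contra hne
  simp [hne] at this

theorem field_add_field_add_ne_zero
    (hindep : LinearIndependent ℚ (Sum.elim ![γ, ω] ωS : Fin 2 ⊕ S → ℝ))
    (i j : V) (m : ℤ) :
    field S ωS ω i + field S ωS ω j + γ * m ≠ 0 := by
  intro h
  have := coeff_eq_zero_of_linearIndependent hindep (fieldIndex_ne i) (y := fieldIndex S j)
    (b := 1) (m := m) (g := Sum.inl 0) (by
      simp only [elim_fieldIndex, Sum.elim_inl, Matrix.cons_val_zero]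
      push_cast
      linarith)
  split_ifs at this <;> norm_num at this

end Independence

/-! ### An odd function recognising a given field in an energy difference -/

section Detection

/-- Detects whether a frequency difference has the form `± 2 (τ + γ m)` and with which sign. -/
noncomputable def detect (γ τ t : ℝ) : ℝ :=
  open scoped Classical in
  if ∃ m : ℤ, t = 2 * (τ + γ * m) then 1 else if ∃ m : ℤ, -t = 2 * (τ + γ * m) then -1 else 0

variable {V : Type*} [DecidableEq V] {S : Finset V} {γ : ℝ} {ωS : S → ℝ} {ω : ℝ}

/-- If `t` and `-t` both had the form `2 (τ + γ m)`, adding the two equations would give a relation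
`τ + τ + γ (m + m') = 0`, which independence forbids. -/
theorem detect_neg
    (hindep : LinearIndependent ℚ (Sum.elim ![γ, ω] ωS : Fin 2 ⊕ S → ℝ)) (j : V) (t : ℝ) :
    detect γ (field S ωS ω j) (-t) = -detect γ (field S ωS ω j) t := by
  unfold detect
  rw [neg_neg]
  split_ifs with h1 h2 h2
  · obtain ⟨m, hm⟩ := h1
    obtain ⟨m', hm'⟩ := h2
    refine absurd ?_ (field_add_field_add_ne_zero hindep j j (m + m'))
    push_cast
    linarith
  all_goals norm_num

theorem detect_spin_mul
    (hindep : LinearIndependent ℚ (Sum.elim ![γ, ω] ωS : Fin 2 ⊕ S → ℝ)) (i j : V) (x : Fin 2)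
    (m : ℤ) :
    detect γ (field S ωS ω j) (spin x * (2 * (field S ωS ω i + γ * m))) =
      if fieldIndex S i = fieldIndex S j then (spin x : ℝ) else 0 := by
  wlog hx : spin x = 1 generalizing x
  · obtain ⟨y, hy⟩ : ∃ y : Fin 2, x ≠ y := ⟨1 - x, by fin_cases x <;> decide⟩
    have h := this y (by
      rw [spin_eq_neg hy]
      rcases spin_eq_or x with h | h
      · exact absurd h hx
      · rw [h, neg_neg])
    rw [spin_eq_neg hy] at h
    push_cast at h
    rw [neg_mul, detect_neg hindep, neg_eq_iff_eq_neg] at h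
    rw [h]
    split_ifs <;> simp
  · classical
    rw [hx, Int.cast_one, one_mul]
    unfold detect
    rw [if_neg (c := ∃ m' : ℤ, -(2 * (field S ωS ω i + γ * m)) = 2 * (field S ωS ω j + γ * m'))]
    · refine if_congr ⟨?_, fun h => ⟨m, ?_⟩⟩ rfl rfl
      · rintro ⟨m', hm⟩
        refine fieldIndex_eq_of_field_eq_add hindep (m := m' - m) ?_
        push_cast
        linarith
      · rw [← elim_fieldIndex γ ωS ω i, h, elim_fieldIndex]
    · rintro ⟨m', hm⟩
      refine field_add_field_add_ne_zero hindep i j (m + m') ?_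
      push_cast
      linarith

end Detection

/-! ### Splitting the mixer according to the fields -/

section Extraction

variable {V : Type*} [Fintype V] [DecidableEq V] {G : SimpleGraph V} [DecidableRel G.Adj]
  {S : Finset V} {γ : ℝ} {ωS : S → ℝ} {ω : ℝ} {L : LieSubalgebra ℝ (Op V)}

theorem apply_eq_of_X_apply_ne_zero {i : V} {a b : V → Fin 2} (h : (X i : Op V) a b ≠ 0) :
    (∀ v, v ≠ i → a v = b v) ∧ a i ≠ b i := by
  rw [X, onQubit_apply] at h
  split_ifs at h with h1
  · refine ⟨h1, fun h2 => h ?_⟩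
    rw [← h2]
    generalize a i = x
    fin_cases x <;> simp [pauliX]
  · exact absurd rfl h

theorem detect_mul_X_apply
    (hindep : LinearIndependent ℚ (Sum.elim ![γ, ω] ωS : Fin 2 ⊕ S → ℝ)) (i j : V)
    (a b : V → Fin 2) :
    (detect γ (field S ωS ω j) (energy G S γ ωS ω a - energy G S γ ωS ω b) : ℂ) * X i a b =
      if fieldIndex S i = fieldIndex S j then (spin (a i) : ℂ) * X i a b else 0 := by
  by_cases h : (X i : Op V) a b = 0
  · simp [h]
  · obtain ⟨h1, h2⟩ := apply_eq_of_X_apply_ne_zero h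
    obtain ⟨m, hm⟩ := exists_energy_sub G S γ ωS ω h1 h2
    rw [hm, detect_spin_mul hindep]
    split_ifs <;> simp

/-- The vertices at which the same field acts as at `j`. -/
def fieldClass (S : Finset V) (j : V) : Finset V := {i | fieldIndex S i = fieldIndex S j}

/-- On the entries of `X i`, `detect` is the spin at `i` if `i` lies in the class of `j` and zero
otherwise, which amounts to left multiplication by `Z i`. As `Z i * X i` is skew-Hermitian, the sum
lies in `L` without a factor `i`. -/
theorem sum_Z_mul_X_mem
    (hZ : costHamiltonian G S γ ωS ω ∈ observables L) (hX : mixerHamiltonian V ∈ observables L)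
    (hindep : LinearIndependent ℚ (Sum.elim ![γ, ω] ωS : Fin 2 ⊕ S → ℝ)) (j : V) :
    ∑ i ∈ fieldClass S j, (Z i : Op V) * X i ∈ L := by
  rw [mem_observables, costHamiltonian_eq_diagonal] at hZ
  have h := of_odd_mul_mem hZ hX (detect_neg hindep j)
  rw [← neg_mem_iff]
  convert h using 1
  ext a b
  simp only [mixerHamiltonian, fieldClass, Matrix.neg_apply, Matrix.sum_apply, Matrix.of_apply,
    Matrix.smul_apply, smul_eq_mul]
  rw [show ∀ x y : ℂ, Complex.I * x * (Complex.I * y) = -(x * y) by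
    intro x y; linear_combination x * y * Complex.I_sq]
  rw [Finset.mul_sum, Finset.sum_filter]
  refine congrArg Neg.neg (Finset.sum_congr rfl fun i _ => ?_)
  rw [detect_mul_X_apply hindep, Z_eq_diagonal, Matrix.diagonal_mul]

/-- The square of `detect` is even and acts as the indicator of the class. -/
theorem sum_X_mem
    (hZ : costHamiltonian G S γ ωS ω ∈ observables L) (hX : mixerHamiltonian V ∈ observables L)
    (hindep : LinearIndependent ℚ (Sum.elim ![γ, ω] ωS : Fin 2 ⊕ S → ℝ)) (j : V) :
    ∑ i ∈ fieldClass S j, (X i : Op V) ∈ observables L := by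
  rw [mem_observables, costHamiltonian_eq_diagonal] at hZ
  have h := of_even_mul_mem hZ hX (f := fun t => detect γ (field S ωS ω j) t ^ 2)
    (fun t => by rw [detect_neg hindep, neg_sq])
  rw [mem_observables]
  convert h using 1
  ext a b
  simp only [mixerHamiltonian, fieldClass, Matrix.sum_apply, Matrix.of_apply,
    Matrix.smul_apply, smul_eq_mul]
  rw [mul_left_comm, Finset.sum_filter]
  refine congrArg (Complex.I * ·) ?_
  rw [Finset.mul_sum]
  refine Finset.sum_congr rfl fun i _ => ?_
  rw [Complex.ofReal_pow, sq, mul_assoc, detect_mul_X_apply hindep]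
  split_ifs with hij
  · rw [mul_left_comm, detect_mul_X_apply hindep, if_pos hij, ← mul_assoc, ← Int.cast_mul]
    rcases spin_eq_or (a i) with h | h <;> simp [h]
  · rw [mul_zero]

theorem sum_Z_mem
    (hZ : costHamiltonian G S γ ωS ω ∈ observables L) (hX : mixerHamiltonian V ∈ observables L)
    (hindep : LinearIndependent ℚ (Sum.elim ![γ, ω] ωS : Fin 2 ⊕ S → ℝ)) (j : V) :
    ∑ i ∈ fieldClass S j, (Z i : Op V) ∈ observables L := by
  have h := L.lie_mem (sum_X_mem hZ hX hindep j) (sum_Z_mul_X_mem hZ hX hindep j)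
  have h2 := L.smul_mem (-2⁻¹ : ℝ) h
  rw [mem_observables]
  convert h2 using 1
  -- Terms at different qubits commute; at one qubit `X Z X - Z X X = -2 Z`.
  have key : (∑ i ∈ fieldClass S j, (X i : Op V)) * ∑ i ∈ fieldClass S j, Z i * X i -
      (∑ i ∈ fieldClass S j, Z i * X i) * ∑ i ∈ fieldClass S j, X i =
      (-2 : ℝ) • ∑ i ∈ fieldClass S j, Z i := by
    rw [Finset.sum_mul_sum, Finset.sum_mul_sum, Finset.sum_comm, ← Finset.sum_sub_distrib,
      Finset.smul_sum]
    refine Finset.sum_congr rfl fun i hi => ?_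
    rw [← Finset.sum_sub_distrib, Finset.sum_eq_single i]
    · rw [← mul_assoc, X_mul_Z_self, mul_assoc (Z i), neg_mul, mul_assoc (Z i), X_mul_self,
        mul_one]
      module
    · intro k _ hk
      rw [← mul_assoc, X_mul_Z_comm hk, mul_assoc, mul_assoc, sub_eq_zero]
      congr 1
      exact onQubit_comm hk _ _
    · exact fun h => absurd hi h
  rw [Ring.lie_def, smul_mul_assoc, mul_smul_comm, ← smul_sub, key]
  module

end Extraction

/-! ### Propagation along the zero forcing process -/

section Forcing

variable {V : Type*} [Fintype V] [DecidableEq V] {G : SimpleGraph V} [DecidableRel G.Adj]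
  {S : Finset V} {γ : ℝ} {ωS : S → ℝ} {ω : ℝ} {L : LieSubalgebra ℝ (Op V)}

theorem fieldClass_of_mem {j : V} (hj : j ∈ S) : fieldClass S j = {j} := by
  ext i
  simp only [fieldClass, Finset.mem_filter, Finset.mem_univ, true_and, Finset.mem_singleton,
    fieldIndex, dif_pos hj]
  refine ⟨fun h => ?_, fun h => by simp [h, hj]⟩
  split_ifs at h
  simpa using h

theorem fieldClass_of_notMem {j : V} (hj : j ∉ S) : fieldClass S j = Sᶜ := by
  ext i
  simp only [fieldClass, Finset.mem_filter, Finset.mem_univ, true_and, Finset.mem_compl,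
    fieldIndex, dif_neg hj]
  split_ifs with h <;> simp [h]

theorem sum_compl_Z_mem
    (hZ : costHamiltonian G S γ ωS ω ∈ observables L) (hX : mixerHamiltonian V ∈ observables L)
    (hindep : LinearIndependent ℚ (Sum.elim ![γ, ω] ωS : Fin 2 ⊕ S → ℝ)) :
    ∑ i ∈ Sᶜ, (Z i : Op V) ∈ observables L := by
  rcases (Sᶜ).eq_empty_or_nonempty with h | ⟨j, hj⟩
  · rw [h, Finset.sum_empty]
    exact (observables L).zero_mem
  · rw [← fieldClass_of_notMem (Finset.mem_compl.1 hj)]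
    exact sum_Z_mem hZ hX hindep j

theorem X_mem_of_mem
    (hZ : costHamiltonian G S γ ωS ω ∈ observables L) (hX : mixerHamiltonian V ∈ observables L)
    (hindep : LinearIndependent ℚ (Sum.elim ![γ, ω] ωS : Fin 2 ⊕ S → ℝ)) {j : V} (hj : j ∈ S) :
    X j ∈ observables L := by
  simpa [fieldClass_of_mem hj] using sum_X_mem hZ hX hindep j

theorem Z_mem_of_mem
    (hZ : costHamiltonian G S γ ωS ω ∈ observables L) (hX : mixerHamiltonian V ∈ observables L)
    (hindep : LinearIndependent ℚ (Sum.elim ![γ, ω] ωS : Fin 2 ⊕ S → ℝ)) {j : V} (hj : j ∈ S) :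
    Z j ∈ observables L := by
  simpa [fieldClass_of_mem hj] using sum_Z_mem hZ hX hindep j

theorem sum_edgeZZ_mem
    (hZ : costHamiltonian G S γ ωS ω ∈ observables L) (hX : mixerHamiltonian V ∈ observables L)
    (hindep : LinearIndependent ℚ (Sum.elim ![γ, ω] ωS : Fin 2 ⊕ S → ℝ)) :
    ∑ e ∈ G.edgeFinset, edgeZZ e ∈ observables L := by
  have hγ : γ ≠ 0 := hindep.ne_zero (Sum.inl 0)
  rw [← (observables L).smul_mem_iff hγ]
  have h1 : ∑ i : S, ωS i • (Z (i : V) : Op V) ∈ observables L :=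
    Submodule.sum_mem _ fun i _ =>
      Submodule.smul_mem _ _ (Z_mem_of_mem hZ hX hindep i.2)
  have h2 := (observables L).smul_mem ω (sum_compl_Z_mem hZ hX hindep)
  have h3 := (observables L).sub_mem ((observables L).sub_mem hZ h2) h1
  rwa [costHamiltonian, add_sub_cancel_right, add_sub_cancel_right] at h3

theorem sum_incident_mem (hE : ∑ e ∈ G.edgeFinset, edgeZZ e ∈ observables L) {v : V}
    (hv : X v ∈ observables L) : ∑ e ∈ G.edgeFinset with v ∈ e, edgeZZ e ∈ observables L :=
  sum_filter_mem hv (X_mul_self v) hE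
    (fun _ he => X_mul_edgeZZ_of_mem (G.not_isDiag_of_mem_edgeFinset he))
    (fun _ _ => X_mul_edgeZZ_of_notMem)

/-- Filtering the edges by `X u` and then by `X v` leaves the single edge containing both endpoints.
-/
theorem Z_mul_Z_mem (hE : ∑ e ∈ G.edgeFinset, edgeZZ e ∈ observables L) {u v : V}
    (hu : X u ∈ observables L) (hv : X v ∈ observables L) (huv : G.Adj u v) :
    Z u * Z v ∈ observables L := by
  have h := sum_filter_mem (p := fun e => v ∈ e) hv (X_mul_self v) (sum_incident_mem hE hu)
    (fun _ he => X_mul_edgeZZ_of_mem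
      (G.not_isDiag_of_mem_edgeFinset (Finset.mem_of_mem_filter _ he)))
    (fun _ _ => X_mul_edgeZZ_of_notMem)
  have hs : {e ∈ G.edgeFinset.filter (u ∈ ·) | v ∈ e} = {s(u, v)} := by
    ext e
    simp only [Finset.mem_filter, Finset.mem_singleton, SimpleGraph.mem_edgeFinset]
    constructor
    · rintro ⟨⟨_, h1⟩, h2⟩
      exact (Sym2.mem_and_mem_iff huv.ne).1 ⟨h1, h2⟩
    · rintro rfl
      simpa using huv
  rw [hs, Finset.sum_singleton] at h
  exact h

theorem forcingStep_mem (hX : mixerHamiltonian V ∈ observables L)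
    (hE : ∑ e ∈ G.edgeFinset, edgeZZ e ∈ observables L)
    (hZ : ∑ i ∈ Sᶜ, (Z i : Op V) ∈ observables L) {A B : Finset V} (hSA : S ⊆ A)
    (hA : ∀ a ∈ A, X a ∈ observables L ∧ Z a ∈ observables L) (hAB : ForcingStep G A B) :
    ∀ b ∈ B, X b ∈ observables L ∧ Z b ∈ observables L := by
  obtain ⟨v, hv, w, hw, hvw, hforce, rfl⟩ := hAB
  -- Every edge at `v` other than `{v, w}` ends at an infected vertex, so its term is already
  -- available and can be subtracted.
  have hzz : edgeZZ s(v, w) ∈ observables L := by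
    have hmem : s(v, w) ∈ G.edgeFinset.filter (v ∈ ·) := by simpa using hvw
    have h := sum_incident_mem hE (hA v hv).1
    rw [← Finset.add_sum_erase _ _ hmem] at h
    refine ((observables L).add_mem_iff_left (Submodule.sum_mem _ fun e he => ?_)).1 h
    rw [Finset.mem_erase, Finset.mem_filter, SimpleGraph.mem_edgeFinset] at he
    obtain ⟨hne, he, u, rfl⟩ := he
    have hu : u ∈ A := by
      by_contra hu
      exact hne (by rw [hforce u hu he])
    exact Z_mul_Z_mem hE (hA v hv).1 (hA u hu).1 he
  -- The edge term anticommutes with exactly `X v` and `X w` among the summands of the mixer, and `X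
  -- v` is known.
  have hXw : X w ∈ observables L := by
    have hd : ¬ (s(v, w)).IsDiag := by simpa using hvw.ne
    have h := sum_filter_mem (p := fun i => i ∈ s(v, w)) hzz (edgeZZ_mul_self _) hX
      (fun i _ hi => by rw [X_mul_edgeZZ_of_mem hd hi, neg_neg])
      (fun i _ hi => (X_mul_edgeZZ_of_notMem hi).symm)
    have hs : ({i | i ∈ s(v, w)} : Finset V) = {v, w} := by
      ext i; simp
    rw [hs, Finset.sum_pair hvw.ne] at h
    exact ((observables L).add_mem_iff_right (hA v hv).1).1 h
  -- Since `w ∉ S`, `Z w` is a summand of the sum over `Sᶜ`, the only one anticommuting with `X w`.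
  have hZw : Z w ∈ observables L := by
    have h := sum_filter_mem (p := fun i => i = w) hXw (X_mul_self w) hZ
      (fun i _ hi => by rw [hi, X_mul_Z_self]) (fun i _ hi => X_mul_Z_comm (Ne.symm hi))
    rwa [Finset.filter_eq', if_pos (Finset.mem_compl.2 fun h => hw (hSA h)),
      Finset.sum_singleton] at h
  intro b hb
  rcases Finset.mem_insert.1 hb with rfl | hb
  · exact ⟨hXw, hZw⟩
  · exact hA b hb

theorem X_Z_mem_of_isZeroForcingSet
    (hZ : costHamiltonian G S γ ωS ω ∈ observables L) (hX : mixerHamiltonian V ∈ observables L)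
    (hindep : LinearIndependent ℚ (Sum.elim ![γ, ω] ωS : Fin 2 ⊕ S → ℝ))
    (hS : IsZeroForcingSet G S) (v : V) : X v ∈ observables L ∧ Z v ∈ observables L := by
  have hE := sum_edgeZZ_mem hZ hX hindep
  have hc := sum_compl_Z_mem hZ hX hindep
  suffices h : ∀ B, Relation.ReflTransGen (ForcingStep G) S B →
      S ⊆ B ∧ ∀ b ∈ B, X b ∈ observables L ∧ Z b ∈ observables L from
    (h _ hS).2 v (Finset.mem_univ v)
  intro B hB
  induction hB with
  | refl => exact ⟨subset_rfl, fun a ha =>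
      ⟨X_mem_of_mem hZ hX hindep ha, Z_mem_of_mem hZ hX hindep ha⟩⟩
  | tail _ hstep ih =>
    refine ⟨ih.1.trans ?_, forcingStep_mem hX hE hc ih.1 ih.2 hstep⟩
    obtain ⟨v, _, w, _, _, _, rfl⟩ := hstep
    exact Finset.subset_insert _ _

end Forcing

/-! ### Generation of all nonidentity Pauli strings on a connected graph -/

section Strings

variable {V : Type*} [Fintype V] [DecidableEq V] {G : SimpleGraph V}
  {L : LieSubalgebra ℝ (Op V)}

/-- Two tensor products whose factors commute except for anticommuting Pauli matrices at `k`. -/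
theorem tensor_commutator_mem {A B : V → Matrix (Fin 2) (Fin 2) ℂ} {k : V} {c : Fin 3}
    (hA : tensor A ∈ observables L) (hB : tensor B ∈ observables L) (hAk : A k = pauli (c + 1))
    (hBk : B k = pauli (c + 2)) (hAB : ∀ v, v ≠ k → A v * B v = B v * A v) :
    tensor (Function.update (A * B) k (pauli c)) ∈ observables L := by
  have h := (observables L).smul_mem (-2⁻¹ : ℝ) (I_smul_commutator_mem hA hB)
  convert h using 1
  have h1 : A * B = Function.update (A * B) k (Complex.I • pauli c) := by
    rw [← pauli_mul_succ, ← hAk, ← hBk]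
    exact (Function.update_eq_self k (A * B)).symm
  have h2 : B * A = Function.update (A * B) k (-(Complex.I • pauli c)) := by
    rw [← pauli_succ_mul, ← hAk, ← hBk]
    funext v
    by_cases hv : v = k
    · subst hv; simp
    · simp [hv, hAB]
  rw [tensor_mul, tensor_mul, h1, h2, Function.update_idem, tensor_update_neg, tensor_update_smul,
    sub_neg_eq_add, ← two_smul ℂ, smul_smul, smul_smul,
    show Complex.I * 2 * Complex.I = ((-2 : ℝ) : ℂ) by
      push_cast; linear_combination 2 * Complex.I_sq, Complex.coe_smul, smul_smul]
  norm_num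

theorem onQubit_pauli_mem (hP : ∀ v, X v ∈ observables L ∧ Z v ∈ observables L) (k : V)
    (c : Fin 3) : onQubit k (pauli c) ∈ observables L := by
  fin_cases c
  · exact (hP k).1
  · have h := tensor_commutator_mem (A := Pi.mulSingle k pauliZ) (B := Pi.mulSingle k pauliX)
      (k := k) (c := 1) (hP k).2 (hP k).1 (Pi.mulSingle_eq_same _ _) (Pi.mulSingle_eq_same _ _)
      (fun v hv => by simp [hv])
    convert h using 1
    refine congrArg tensor (funext fun v => ?_)
    by_cases hv : v = k
    · subst hv; simp
    · simp [hv]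
  · exact (hP k).2

theorem tensor_update_pauli_mem (hP : ∀ v, X v ∈ observables L ∧ Z v ∈ observables L)
    {A : V → Matrix (Fin 2) (Fin 2) ℂ} (hA : tensor A ∈ observables L) {k : V} {d : Fin 3}
    (hAk : A k = pauli d) (c : Fin 3) :
    tensor (Function.update A k (pauli c)) ∈ observables L := by
  obtain rfl | rfl | rfl : d = c ∨ d = c + 1 ∨ d = c + 2 := by
    fin_cases c <;> fin_cases d <;> decide
  · rwa [← hAk, Function.update_eq_self]
  · have h := tensor_commutator_mem (B := Pi.mulSingle k (pauli (c + 2))) hA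
      (onQubit_pauli_mem hP k _) hAk (Pi.mulSingle_eq_same _ _) (fun v hv => by simp [hv])
    convert h using 1
    refine congrArg tensor (funext fun v => ?_)
    by_cases hv : v = k
    · subst hv; simp
    · simp [hv]
  · have h := tensor_commutator_mem (A := Pi.mulSingle k (pauli (c + 1)))
      (onQubit_pauli_mem hP k _) hA (Pi.mulSingle_eq_same _ _) hAk (fun v hv => by simp [hv])
    convert h using 1
    refine congrArg tensor (funext fun v => ?_)
    by_cases hv : v = k
    · subst hv; simp
    · simp [hv]

theorem tensor_edge_mem (hP : ∀ v, X v ∈ observables L ∧ Z v ∈ observables L) {k l : V}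
    (hkl : k ≠ l) (hZ : Z k * Z l ∈ observables L) (c d : Fin 3) :
    tensor (Pi.mulSingle k (pauli c) * Pi.mulSingle l (pauli d)) ∈ observables L := by
  rw [Z, Z, onQubit, onQubit, tensor_mul] at hZ
  have h := tensor_update_pauli_mem hP (tensor_update_pauli_mem hP hZ (k := k) (d := 2)
    (by simp [hkl, pauli_two]) c) (k := l) (d := 2) (by simp [hkl.symm, pauli_two]) d
  convert h using 1
  refine congrArg tensor (funext fun v => ?_)
  by_cases hv : v = k
  · subst hv; simp [hkl]
  · by_cases hv' : v = l
    · subst hv'; simp [hv]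
    · simp [hv, hv']

/-- A commutator at `l` yields a three-qubit string with `pauli 0` at `l`. A commutator at `k` with
another string carrying `pauli 0` at `l` then erases that factor, as it squares to one. -/
theorem tensor_pair_trans {k l m : V} (hkl : k ≠ l) (hlm : l ≠ m) (hkm : k ≠ m)
    (h1 : ∀ c d : Fin 3,
      tensor (Pi.mulSingle k (pauli c) * Pi.mulSingle l (pauli d)) ∈ observables L)
    (h2 : ∀ c d : Fin 3,
      tensor (Pi.mulSingle l (pauli c) * Pi.mulSingle m (pauli d)) ∈ observables L)
    (c d : Fin 3) :
    tensor (Pi.mulSingle k (pauli c) * Pi.mulSingle m (pauli d)) ∈ observables L := by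
  have h3 := tensor_commutator_mem (k := l) (c := 0) (h1 (c + 1) 1) (h2 2 d)
    (by simp [hkl.symm]) (by simp [hlm]) fun v hv => by
      by_cases hk : v = k
      · subst hk; simp [hkl, hkm]
      · simp [hk, hv]
  have h4 := tensor_commutator_mem (k := k) (c := c) h3 (h1 (c + 2) 0)
    (by simp [hkl, hkm]) (by simp [hkl]) fun v hv => by
      by_cases hl : v = l
      · subst hl; simp [hv]
      · simp [hl, hv]
  convert h4 using 1
  refine congrArg tensor (funext fun v => ?_)
  by_cases hk : v = k
  · subst hk; simp [hkm]
  · by_cases hl : v = l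
    · subst hl; simp [hk, hlm, pauli_mul_self]
    · simp [hk, hl]

theorem tensor_pair_mem (hP : ∀ v, X v ∈ observables L ∧ Z v ∈ observables L)
    (hE : ∀ k l, G.Adj k l → Z k * Z l ∈ observables L) (hG : G.Connected) {k l : V}
    (hkl : k ≠ l) (c d : Fin 3) :
    tensor (Pi.mulSingle k (pauli c) * Pi.mulSingle l (pauli d)) ∈ observables L := by
  have hr : Relation.ReflTransGen G.Adj k l :=
    (SimpleGraph.reachable_iff_reflTransGen k l).1 (hG.preconnected k l)
  suffices h : k ≠ l → ∀ c d : Fin 3,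
      tensor (Pi.mulSingle k (pauli c) * Pi.mulSingle l (pauli d)) ∈ observables L from h hkl c d
  clear hkl c d
  induction hr with
  | refl => exact fun h => absurd rfl h
  | @tail l m _ hlm ih =>
    intro hkm
    -- The path may return to its start `k`; then the last edge alone joins `k` to `m`.
    rcases eq_or_ne k l with rfl | hkl
    · exact tensor_edge_mem hP hkm (hE _ _ hlm)
    · exact tensor_pair_trans hkl hlm.ne hkm (ih hkl) (tensor_edge_mem hP hlm.ne (hE _ _ hlm))

theorem tensor_support_mem (hP : ∀ v, X v ∈ observables L ∧ Z v ∈ observables L)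
    (hE : ∀ k l, G.Adj k l → Z k * Z l ∈ observables L) (hG : G.Connected) {T : Finset V}
    (hT : T.Nonempty) (p : V → Fin 3) :
    tensor (fun v => if v ∈ T then pauli (p v) else 1) ∈ observables L := by
  induction hT using Finset.Nonempty.cons_induction generalizing p with
  | singleton k =>
    convert onQubit_pauli_mem hP k (p k) using 1
    refine congrArg tensor (funext fun v => ?_)
    by_cases hv : v = k
    · subst hv; simp
    · simp [hv]
  | cons l T hl hT ih =>
    obtain ⟨k, hk⟩ := hT
    have hkl : k ≠ l := fun h => hl (h ▸ hk)
    -- The support grows by `l` through a two-qubit string on `k` and `l`. The labels `p k + 1` and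
    -- `p k + 2` at `k` make the commutator carry `p k` there.
    have h := tensor_commutator_mem (k := k) (c := p k) (ih (Function.update p k (p k + 1)))
      (tensor_pair_mem hP hE hG hkl (p k + 2) (p l)) (by simp [hk]) (by simp [hkl])
      fun v hv => by
        by_cases hvl : v = l
        · subst hvl; simp [hl]
        · simp [hv, hvl]
    convert h using 1
    refine congrArg tensor (funext fun v => ?_)
    by_cases hvk : v = k
    · subst hvk; simp [hk]
    · by_cases hvl : v = l
      · subst hvl; simp [hl, hvk]
      · simp [hvk, hvl]

end Strings

/-! ### Pauli strings span all matrices -/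

section Span

/-- The Pauli matrices together with the identity. -/
def pauliOne : Option (Fin 3) → Matrix (Fin 2) (Fin 2) ℂ
  | none => 1
  | some c => pauli c

theorem pauliOne_isHermitian (o : Option (Fin 3)) : (pauliOne o).IsHermitian := by
  cases o with
  | none => exact Matrix.isHermitian_one
  | some c => exact pauli_isHermitian c

theorem exists_eq_sum_pauliOne (M : Matrix (Fin 2) (Fin 2) ℂ) :
    ∃ c : Option (Fin 3) → ℂ, M = c none • pauliOne none + (c (some 0) • pauliOne (some 0) +
      (c (some 1) • pauliOne (some 1) + c (some 2) • pauliOne (some 2))) := by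
  -- The coefficients are the half traces of `M` times each basis matrix.
  refine ⟨fun o => o.elim ((M 0 0 + M 1 1) / 2) ![(M 0 1 + M 1 0) / 2,
    Complex.I * (M 0 1 - M 1 0) / 2, (M 0 0 - M 1 1) / 2], ?_⟩
  ext a b
  fin_cases a <;> fin_cases b <;> simp [pauliOne, pauli, pauliX, pauliZ] <;>
    first
    | ring1
    | linear_combination ((M 0 1 - M 1 0) / 2) * Complex.I_sq
    | linear_combination (-(M 0 1 - M 1 0) / 2) * Complex.I_sq

variable {V : Type*} [Fintype V] [DecidableEq V]

/-- Multilinearity: `s` holds the sites still to be expanded in the Pauli basis. -/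
theorem tensor_mem_span (s : Finset V) (A : V → Matrix (Fin 2) (Fin 2) ℂ)
    (hA : ∀ v ∉ s, A v ∈ Set.range pauliOne) :
    tensor A ∈ Submodule.span ℂ (Set.range fun p : V → Option (Fin 3) =>
      tensor fun v => pauliOne (p v)) := by
  induction s using Finset.induction_on generalizing A with
  | empty =>
    choose p hp using fun v => hA v (Finset.notMem_empty v)
    exact Submodule.subset_span ⟨p, congrArg tensor (funext hp)⟩
  | insert v s _ ih =>
    obtain ⟨c, hc⟩ := exists_eq_sum_pauliOne (A v)
    have key (o : Option (Fin 3)) := ih (Function.update A v (pauliOne o)) fun u hu => by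
      by_cases huv : u = v
      · subst huv; simp
      · rw [Function.update_of_ne huv]
        exact hA u (by simp [huv, hu])
    rw [← Function.update_eq_self v A, hc]
    simp only [tensor_update_add, tensor_update_smul]
    exact add_mem (Submodule.smul_mem _ _ (key _)) (add_mem (Submodule.smul_mem _ _ (key _))
      (add_mem (Submodule.smul_mem _ _ (key _)) (Submodule.smul_mem _ _ (key _))))

theorem single_eq_tensor (a b : V → Fin 2) :
    (Matrix.single a b 1 : Op V) = tensor fun v => Matrix.single (a v) (b v) 1 := by
  ext x y
  simp only [Matrix.single_apply, tensor, Matrix.of_apply, Finset.prod_ite_zero,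
    Finset.prod_const_one]
  refine if_congr ?_ rfl rfl
  simp [funext_iff, forall_and]

theorem span_tensor_pauliOne :
    Submodule.span ℂ (Set.range fun p : V → Option (Fin 3) => tensor fun v => pauliOne (p v)) =
      ⊤ := by
  refine Submodule.eq_top_iff'.2 fun M => ?_
  rw [Matrix.matrix_eq_sum_single M]
  refine Submodule.sum_mem _ fun a _ => Submodule.sum_mem _ fun b _ => ?_
  rw [← mul_one (M a b), ← smul_eq_mul, ← Matrix.smul_single, single_eq_tensor]
  exact Submodule.smul_mem _ _ (tensor_mem_span Finset.univ _ fun v hv =>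
    absurd (Finset.mem_univ v) hv)

/-- A Lie algebra that contains `i P` for all tensor products `P` of Pauli matrices contains all
skew-Hermitian matrices. -/
theorem isHermitian_mem_observables {L : LieSubalgebra ℝ (Op V)}
    (hL : ∀ p : V → Option (Fin 3), tensor (fun v => pauliOne (p v)) ∈ observables L) {A : Op V}
    (hA : A.IsHermitian) : A ∈ observables L := by
  -- Quantifying over `c` makes the claim stable under complex scalars. On a string `P` the
  -- expression is `2 Re(c) P`; for Hermitian `A` and `c = 1/2` it is `A`.
  have h : ∀ M ∈ Submodule.span ℂ (Set.range fun p : V → Option (Fin 3) =>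
      tensor fun v => pauliOne (p v)), ∀ c : ℂ, c • M + (c • M).conjTranspose ∈ observables L := by
    intro M hM
    induction hM using Submodule.span_induction with
    | mem M hM =>
      obtain ⟨p, rfl⟩ := hM
      intro c
      have hp : (tensor fun v => pauliOne (p v)).IsHermitian :=
        tensor_isHermitian fun v => pauliOne_isHermitian (p v)
      rw [Matrix.conjTranspose_smul, hp.eq, ← add_smul, Complex.star_def, Complex.add_conj,
        Complex.coe_smul]
      exact (observables L).smul_mem _ (hL p)
    | zero => simp
    | add M N _ _ hM hN =>
      intro c
      convert add_mem (hM c) (hN c) using 1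
      rw [smul_add, Matrix.conjTranspose_add]
      abel
    | smul r M _ hM =>
      intro c
      rw [smul_smul]
      exact hM _
  have h1 := h A (by rw [span_tensor_pauliOne]; trivial) (2⁻¹ : ℝ)
  rwa [Complex.coe_smul, Matrix.conjTranspose_smul, hA.eq, star_trivial, ← add_smul,
    show (2⁻¹ : ℝ) + 2⁻¹ = 1 by norm_num, one_smul] at h1

/-- The identity is a separate hypothesis because it has nonzero trace, whereas commutators and the
other Pauli strings are traceless. -/
theorem isHermitian_mem_of_connected {G : SimpleGraph V} {L : LieSubalgebra ℝ (Op V)}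
    (hP : ∀ v, X v ∈ observables L ∧ Z v ∈ observables L)
    (hE : ∀ k l, G.Adj k l → Z k * Z l ∈ observables L) (hG : G.Connected)
    (h1 : 1 ∈ observables L) {A : Op V} (hA : A.IsHermitian) : A ∈ observables L := by
  refine isHermitian_mem_observables (fun p => ?_) hA
  rcases (Finset.univ.filter fun v => p v ≠ none).eq_empty_or_nonempty with h | h
  · have hp : ∀ v, p v = none := fun v => by
      simpa using Finset.filter_eq_empty_iff.1 h (Finset.mem_univ v)
    simpa only [hp, pauliOne] using tensor_one (V := V) ▸ h1
  · convert tensor_support_mem hP hE hG h fun v => (p v).getD 0 using 2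
    funext v
    cases hv : p v <;> simp [hv, pauliOne]

end Span

/-! ### Closed submonoids of the unitary group and their Lie algebras -/

section ClosedSubmonoid

open Filter Topology

variable {A : Type*} [CStarAlgebra A]

theorem norm_le_one_of_mem_unitary {u : A} (hu : u ∈ unitary A) : ‖u‖ ≤ 1 := by
  rcases subsingleton_or_nontrivial A with _ | _
  · rw [Subsingleton.elim u 0, norm_zero]
    exact zero_le_one
  · exact (CStarRing.norm_of_mem_unitary hu).le

theorem norm_pow_sub_pow_le_of_norm_le_one {a b : A} (ha : ‖a‖ ≤ 1) (hb : ∀ n, ‖b ^ n‖ ≤ 1)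
    (n : ℕ) : ‖a ^ n - b ^ n‖ ≤ n * ‖a - b‖ := by
  induction n with
  | zero => simp
  | succ n ih =>
    have h : a ^ (n + 1) - b ^ (n + 1) = a * (a ^ n - b ^ n) + (a - b) * b ^ n := by
      rw [pow_succ', pow_succ']
      noncomm_ring
    rw [h]
    push_cast
    calc ‖a * (a ^ n - b ^ n) + (a - b) * b ^ n‖
        ≤ ‖a‖ * ‖a ^ n - b ^ n‖ + ‖a - b‖ * ‖b ^ n‖ :=
          (norm_add_le _ _).trans (add_le_add (norm_mul_le _ _) (norm_mul_le _ _))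
      _ ≤ 1 * (n * ‖a - b‖) + ‖a - b‖ * 1 := by
          gcongr
          exact hb n
      _ = (n + 1) * ‖a - b‖ := by ring

theorem exp_mem_unitary {x : A} (hx : x ∈ skewAdjoint A) : NormedSpace.exp x ∈ unitary A :=
  let _ : NormedAlgebra ℚ A := .restrictScalars ℚ ℂ A
  NormedSpace.exp_mem_unitary_of_mem_skewAdjoint hx

theorem exp_add_smul (x : A) (s t : ℝ) :
    NormedSpace.exp ((s + t) • x) = NormedSpace.exp (s • x) * NormedSpace.exp (t • x) := by
  let _ : NormedAlgebra ℚ A := .restrictScalars ℚ ℂ A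
  rw [add_smul, NormedSpace.exp_add_of_commute ((Commute.refl x).smul_left s |>.smul_right t)]

theorem exp_nat_mul_smul (x : A) (n : ℕ) (t : ℝ) :
    NormedSpace.exp ((n * t) • x) = NormedSpace.exp (t • x) ^ n := by
  let _ : NormedAlgebra ℚ A := .restrictScalars ℚ ℂ A
  rw [← NormedSpace.exp_nsmul, mul_smul, Nat.cast_smul_eq_nsmul]

theorem star_exp_smul {x : A} (hx : x ∈ skewAdjoint A) (t : ℝ) :
    star (NormedSpace.exp (t • x)) = NormedSpace.exp ((-t) • x) := by
  rw [NormedSpace.star_exp, star_smul, skewAdjoint.mem_iff.1 hx, star_trivial, smul_neg, neg_smul]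

theorem hasDerivAt_exp_smul_zero (x : A) :
    HasDerivAt (fun t : ℝ => NormedSpace.exp (t • x)) x 0 := by
  simpa [NormedSpace.exp_zero] using hasDerivAt_exp_smul_const (𝕂 := ℝ) x 0

/-- The Lie product formula for skew-adjoint elements. -/
theorem tendsto_exp_mul_exp_pow {x y : A} (hx : x ∈ skewAdjoint A) (hy : y ∈ skewAdjoint A) :
    Tendsto (fun n : ℕ => (NormedSpace.exp ((n : ℝ)⁻¹ • x) * NormedSpace.exp ((n : ℝ)⁻¹ • y)) ^ n)
      atTop (𝓝 (NormedSpace.exp (x + y))) := by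
  -- The two curves agree to first order at `0`, so their difference at `1/n` is `o(1/n)`; taking
  -- `n`-th powers costs at most a factor `n`.
  have hd : HasDerivAt (fun t : ℝ => NormedSpace.exp (t • x) * NormedSpace.exp (t • y) -
      NormedSpace.exp (t • (x + y))) 0 0 := by
    exact (((hasDerivAt_exp_smul_zero x).mul (hasDerivAt_exp_smul_zero y)).sub
      (hasDerivAt_exp_smul_zero (x + y))).congr_deriv (by simp [NormedSpace.exp_zero])
  have hinv : Tendsto (fun n : ℕ => (n : ℝ)⁻¹) atTop (𝓝[≠] 0) := by
    refine tendsto_nhdsWithin_iff.2 ⟨tendsto_inv_atTop_nhds_zero_nat, ?_⟩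
    filter_upwards [eventually_gt_atTop 0] with n hn
    simpa using hn.ne'
  have hlim := ((hasDerivAt_iff_tendsto_slope_zero.1 hd).comp hinv).norm
  rw [norm_zero] at hlim
  rw [tendsto_iff_norm_sub_tendsto_zero]
  refine squeeze_zero' (Eventually.of_forall fun _ => norm_nonneg _) ?_ hlim
  filter_upwards [eventually_gt_atTop 0] with n hn
  have hu (z : A) (hz : z ∈ skewAdjoint A) (t : ℝ) : NormedSpace.exp (t • z) ∈ unitary A :=
    exp_mem_unitary (skewAdjoint.smul_mem t hz)
  have he : NormedSpace.exp (x + y) = NormedSpace.exp ((n : ℝ)⁻¹ • (x + y)) ^ n := by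
    rw [← exp_nat_mul_smul, mul_inv_cancel₀ (by positivity), one_smul]
  rw [he]
  refine (norm_pow_sub_pow_le_of_norm_le_one
    (norm_le_one_of_mem_unitary (mul_mem (hu x hx _) (hu y hy _)))
    (fun k => norm_le_one_of_mem_unitary (pow_mem (hu _ (add_mem hx hy) _) k)) n).trans_eq ?_
  simp [norm_smul, NormedSpace.exp_zero]

theorem exp_conj_smul (x y : A) (s t : ℝ) :
    NormedSpace.exp (t • (NormedSpace.exp (s • x) * y * NormedSpace.exp ((-s) • x))) =
      NormedSpace.exp (s • x) * NormedSpace.exp (t • y) * NormedSpace.exp ((-s) • x) := by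
  let _ : NormedAlgebra ℚ A := .restrictScalars ℚ ℂ A
  let u : Aˣ := ⟨NormedSpace.exp (s • x), NormedSpace.exp ((-s) • x),
    by rw [← exp_add_smul, add_neg_cancel, zero_smul, NormedSpace.exp_zero],
    by rw [← exp_add_smul, neg_add_cancel, zero_smul, NormedSpace.exp_zero]⟩
  have h := NormedSpace.exp_units_conj u (t • y)
  rw [mul_smul_comm, smul_mul_assoc] at h
  exact h

variable [FiniteDimensional ℂ A] {K : Submonoid A}

/-- A closed submonoid of the unitary group of a finite-dimensional C⋆-algebra is closed under
inverses. -/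
theorem star_mem_of_isClosed (hK : IsClosed (K : Set A)) (hKu : K ≤ unitary A) {u : A}
    (hu : u ∈ K) : star u ∈ K := by
  have : ProperSpace A := FiniteDimensional.proper ℂ A
  have hb : Bornology.IsBounded (K : Set A) := isBounded_iff_forall_norm_le.2
    ⟨1, fun v hv => norm_le_one_of_mem_unitary (hKu hv)⟩
  -- By compactness some powers of `u` accumulate. If `u ^ φ N` and `u ^ φ (N + 1)` are close, then
  -- `u ^ (φ (N + 1) - φ N - 1)` is close to the inverse of `u`.
  obtain ⟨a, _, φ, hφ, hlim⟩ := tendsto_subseq_of_bounded hb fun n => pow_mem hu n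
  have hcauchy := hlim.cauchySeq
  refine hK.closure_subset (Metric.mem_closure_iff.2 fun ε hε => ?_)
  obtain ⟨N, hN⟩ := Metric.cauchySeq_iff'.1 hcauchy ε hε
  obtain ⟨m, hm⟩ : ∃ m, φ (N + 1) = φ N + 1 + m :=
    Nat.exists_eq_add_of_le (hφ N.lt_succ_self)
  refine ⟨u ^ m, pow_mem hu _, ?_⟩
  have h1 := hN (N + 1) N.le_succ
  rw [dist_comm, dist_eq_norm] at h1
  have hspow : star (u ^ (φ N + 1)) * u ^ (φ N + 1) = 1 :=
    (Unitary.mem_iff.1 (hKu (pow_mem hu _))).1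
  have hv : star u - u ^ m =
      star (u ^ (φ N + 1)) * (u ^ φ N - u ^ φ (N + 1)) := by
    rw [mul_sub]
    congr 1
    · have hp : star (u ^ φ N) * u ^ φ N = 1 := (Unitary.mem_iff.1 (hKu (pow_mem hu _))).1
      rw [pow_succ, star_mul, mul_assoc, hp, mul_one]
    · rw [hm, pow_add u (φ N + 1), ← mul_assoc, hspow, one_mul]
  rw [dist_eq_norm, hv]
  refine (norm_mul_le _ _).trans_lt (lt_of_le_of_lt (mul_le_of_le_one_left (norm_nonneg _) ?_) h1)
  rw [norm_star]
  exact norm_le_one_of_mem_unitary (hKu (pow_mem hu _))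

/-- The Lie algebra of a closed subgroup of the unitary group. -/
def lieAlgebraOf (K : Submonoid A) (hK : IsClosed (K : Set A)) : LieSubalgebra ℝ A :=
  let 𝔨 : Submodule ℝ A :=
    { carrier := {x | x ∈ skewAdjoint A ∧ ∀ t : ℝ, NormedSpace.exp (t • x) ∈ K}
      add_mem' := fun {x y} hx hy => ⟨add_mem hx.1 hy.1, fun t => by
        rw [smul_add]
        refine hK.mem_of_tendsto (tendsto_exp_mul_exp_pow (skewAdjoint.smul_mem t hx.1)
          (skewAdjoint.smul_mem t hy.1)) (Eventually.of_forall fun n => pow_mem (mul_mem ?_ ?_) n)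
        · rw [smul_smul]
          exact hx.2 _
        · rw [smul_smul]
          exact hy.2 _⟩
      zero_mem' := ⟨zero_mem _, fun t => by
        rw [smul_zero, NormedSpace.exp_zero]
        exact one_mem K⟩
      smul_mem' := fun r x hx => ⟨skewAdjoint.smul_mem r hx.1, fun t => by
        rw [smul_smul]
        exact hx.2 _⟩ }
  { 𝔨 with
    lie_mem' := fun {x y} hx hy => by
      -- The bracket is the derivative at `0` of this conjugation curve, which stays in `𝔨`; finite
      -- dimension makes `𝔨` closed.
      have hconj (s : ℝ) :
          NormedSpace.exp (s • x) * y * NormedSpace.exp ((-s) • x) ∈ 𝔨 := by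
        refine ⟨?_, fun t => ?_⟩
        · rw [← star_exp_smul hx.1]
          exact skewAdjoint.conjugate hy.1 _
        · rw [exp_conj_smul]
          exact mul_mem (mul_mem (hx.2 s) (hy.2 t)) (hx.2 _)
      have hneg : HasDerivAt (fun s : ℝ => NormedSpace.exp ((-s) • x)) (-x) 0 := by
        simpa using hasDerivAt_exp_smul_zero (-x)
      have hd : HasDerivAt (fun s : ℝ => NormedSpace.exp (s • x) * y *
          NormedSpace.exp ((-s) • x)) ⁅x, y⁆ 0 := by
        exact (((hasDerivAt_exp_smul_zero x).mul_const y).mul hneg).congr_deriv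
          (by simp [NormedSpace.exp_zero, Ring.lie_def, sub_eq_add_neg])
      have : FiniteDimensional ℝ A := FiniteDimensional.complexToReal A
      refine (Submodule.closed_of_finiteDimensional 𝔨).mem_of_tendsto
        (hasDerivAt_iff_tendsto_slope_zero.1 hd) (Eventually.of_forall fun s => ?_)
      exact 𝔨.smul_mem _ (𝔨.sub_mem (hconj _) (hconj _)) }

theorem mem_lieAlgebraOf {hK : IsClosed (K : Set A)} {x : A} :
    x ∈ lieAlgebraOf K hK ↔ x ∈ skewAdjoint A ∧ ∀ t : ℝ, NormedSpace.exp (t • x) ∈ K := Iff.rfl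

/-- It suffices to check membership in the Lie algebra for short positive times. -/
theorem mem_lieAlgebraOf_of_Icc (hK : IsClosed (K : Set A)) (hKu : K ≤ unitary A) {x : A}
    (hx : x ∈ skewAdjoint A) {T : ℝ} (hT : 0 < T)
    (h : ∀ t ∈ Set.Icc 0 T, NormedSpace.exp (t • x) ∈ K) : x ∈ lieAlgebraOf K hK := by
  have hpos (t : ℝ) (ht : 0 ≤ t) : NormedSpace.exp (t • x) ∈ K := by
    obtain ⟨n, hn⟩ := exists_nat_gt (t / T)
    have hn0 : (0 : ℝ) < n := lt_of_le_of_lt (by positivity) hn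
    rw [← mul_div_cancel₀ t hn0.ne', exp_nat_mul_smul]
    refine pow_mem (h _ ⟨by positivity, ?_⟩) n
    rw [div_le_iff₀ hn0]
    rw [div_lt_iff₀ hT] at hn
    linarith
  refine ⟨hx, fun t => ?_⟩
  rcases le_total 0 t with ht | ht
  · exact hpos t ht
  · rw [← neg_neg t, ← star_exp_smul hx]
    exact star_mem_of_isClosed hK hKu (hpos _ (neg_nonneg.2 ht))

end ClosedSubmonoid

/-! ### Logarithms of unitary matrices -/

section Logarithm

variable {A : Type*} [CStarAlgebra A]

/-- A unitary with finite spectrum is the exponential of `i` times a self-adjoint element. -/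
theorem exists_exp_eq_of_finite_spectrum {u : A} (hu : u ∈ unitary A)
    (hfin : (spectrum ℂ u).Finite) :
    ∃ a : A, IsSelfAdjoint a ∧ NormedSpace.exp (Complex.I • a) = u := by
  have hn : IsStarNormal u := ⟨by
    rw [commute_iff_eq, (Unitary.mem_iff.1 hu).1, (Unitary.mem_iff.1 hu).2]⟩
  -- Any function is continuous on a finite set, so the branch cut of `arg` is harmless.
  have hcont : ContinuousOn (fun z : ℂ => (z.arg : ℂ)) (spectrum ℂ u) := hfin.continuousOn _
  have hsa : IsSelfAdjoint (cfc (fun z : ℂ => (z.arg : ℂ)) u) := IsSelfAdjoint.cfc_arg u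
  refine ⟨cfc (fun z : ℂ => (z.arg : ℂ)) u, hsa, ?_⟩
  rw [← CFC.exp_eq_normedSpace_exp (𝕜 := ℂ), ← cfc_comp_smul .., ← cfc_comp' ..]
  conv_rhs => rw [← cfc_id' ℂ u]
  refine cfc_congr fun z hz => ?_
  have hz1 : ‖z‖ = 1 := spectrum.norm_eq_one_of_unitary hu hz
  have hlog : Complex.I * z.arg = Complex.log z :=
    Complex.ext (by simp [Complex.log_re, hz1]) (by simp [Complex.log_im])
  have hz0 : z ≠ 0 := by
    rintro rfl
    simp at hz1
  simpa [← Complex.exp_eq_exp_ℂ, hlog] using Complex.exp_log hz0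

theorem finite_spectrum_matrix {n : Type*} [Fintype n] [DecidableEq n] (M : Matrix n n ℂ) :
    (spectrum ℂ M).Finite := by
  rw [← AlgEquiv.spectrum_eq (Matrix.toLinAlgEquiv' (R := ℂ) (n := n)) M]
  exact Module.End.finite_spectrum _

end Logarithm

/-! ### From the Lie algebra to approximation by circuits -/

section Universality

open scoped Matrix.Norms.L2Operator

variable {V : Type*} [Fintype V] [DecidableEq V] {HZ HX : Op V}

theorem evolution_zero (H : Op V) : evolution H 0 = 1 := by
  simp [evolution, NormedSpace.exp_zero]

theorem evolution_mem_unitary {H : Op V} (hH : H.IsHermitian) (t : ℝ) :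
    evolution H t ∈ unitary (Op V) := by
  refine exp_mem_unitary (skewAdjoint.mem_iff.2 ?_)
  rw [star_smul, Matrix.star_eq_conjTranspose, hH.eq]
  simp

theorem circuits_mul_mem {W W' : Op V} (hW : W ∈ circuits HZ HX) (hW' : W' ∈ circuits HZ HX) :
    W * W' ∈ circuits HZ HX := by
  simp only [circuits, Set.mem_iUnion] at *
  obtain ⟨p, hp, γ, β, hI, rfl⟩ := hW
  obtain ⟨q, _, γ', β', hI', rfl⟩ := hW'
  -- The product is reversed, so the angles of the right factor `W'` come first.
  refine ⟨q + p, by omega, Fin.append γ' γ, Fin.append β' β, fun j => ?_, ?_⟩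
  · induction j using Fin.addCases with
    | left j => simpa using hI' j
    | right j => simpa using hI j
  · rw [← List.prod_append, ← List.reverse_append]
    congr 2
    rw [List.ofFn_add]
    congr 2
    · funext i
      rw [show Fin.castLE _ i = Fin.castAdd p i from rfl, Fin.append_left, Fin.append_left]
    · funext i
      rw [Fin.append_right, Fin.append_right]

theorem evolution_mul_mem_circuits {s t : ℝ} (hs : s ∈ Set.Icc 0 (2 * Real.pi))
    (ht : t ∈ Set.Icc 0 (2 * Real.pi)) : evolution HX s * evolution HZ t ∈ circuits HZ HX := by
  simp only [circuits, Set.mem_iUnion]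
  exact ⟨1, le_rfl, fun _ => t, fun _ => s, fun _ => ⟨ht, hs⟩, by simp⟩

theorem circuits_subset_unitary (hZ : HZ.IsHermitian) (hX : HX.IsHermitian) :
    circuits HZ HX ⊆ unitary (Op V) := by
  intro W hW
  simp only [circuits, Set.mem_iUnion] at hW
  obtain ⟨p, _, γ, β, _, rfl⟩ := hW
  refine list_prod_mem fun M hM => ?_
  rw [List.mem_reverse, List.mem_ofFn] at hM
  obtain ⟨j, rfl⟩ := hM
  exact mul_mem (evolution_mem_unitary hX _) (evolution_mem_unitary hZ _)

theorem zero_mem_Icc_two_pi : (0 : ℝ) ∈ Set.Icc 0 (2 * Real.pi) :=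
  ⟨le_rfl, Real.two_pi_pos.le⟩

/-- The circuits up to a global phase. -/
def phasedCircuits (HZ HX : Op V) : Submonoid (Op V) where
  carrier := {M | ∃ W ∈ circuits HZ HX, ∃ θ : ℝ, M = Complex.exp (Complex.I * (θ : ℂ)) • W}
  one_mem' := ⟨1, by
    simpa [evolution_zero] using evolution_mul_mem_circuits (HZ := HZ) (HX := HX)
      zero_mem_Icc_two_pi zero_mem_Icc_two_pi, 0, by simp⟩
  mul_mem' := by
    rintro _ _ ⟨W, hW, θ, rfl⟩ ⟨W', hW', θ', rfl⟩
    refine ⟨W * W', circuits_mul_mem hW hW', θ + θ', ?_⟩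
    rw [smul_mul_smul_comm, ← Complex.exp_add]
    push_cast
    rw [mul_add]

theorem circuits_subset_phasedCircuits : circuits HZ HX ⊆ phasedCircuits HZ HX :=
  fun W hW => ⟨W, hW, 0, by simp⟩

theorem phasedCircuits_le_unitary (hZ : HZ.IsHermitian) (hX : HX.IsHermitian) :
    phasedCircuits HZ HX ≤ unitary (Op V) := by
  rintro _ ⟨W, hW, θ, rfl⟩
  have h := circuits_subset_unitary hZ hX hW
  rw [SetLike.mem_coe, Unitary.mem_iff] at h
  have hphase : (starRingEnd ℂ) (Complex.exp (Complex.I * θ)) * Complex.exp (Complex.I * θ) = 1 := by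
    rw [← Complex.exp_conj, ← Complex.exp_add]
    simp
  rw [Unitary.mem_iff, star_smul, smul_mul_smul_comm, smul_mul_smul_comm, h.1, h.2,
    Complex.star_def, hphase, mul_comm, hphase, one_smul]
  exact ⟨rfl, rfl⟩

/-- The Lie algebra rank condition: if the closed group generated by `HZ` and `HX` up to phases
has the full Lie algebra, the pair is universal. -/
theorem isUniversal_of_observables (hZ : HZ.IsHermitian) (hX : HX.IsHermitian)
    (h : ∀ L : LieSubalgebra ℝ (Op V), HZ ∈ observables L → HX ∈ observables L →
      1 ∈ observables L → ∀ A : Op V, A.IsHermitian → A ∈ observables L) :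
    IsUniversal HZ HX := by
  set K := (phasedCircuits HZ HX).topologicalClosure
  have hK : IsClosed (K : Set (Op V)) := (phasedCircuits HZ HX).isClosed_topologicalClosure
  have hKu : K ≤ unitary (Op V) := Submonoid.topologicalClosure_minimal _
    (phasedCircuits_le_unitary hZ hX) isClosed_unitary
  have hle : phasedCircuits HZ HX ≤ K := Submonoid.le_topologicalClosure _
  have hgen (H : Op V) (hH : H.IsHermitian)
      (hc : ∀ t ∈ Set.Icc 0 (2 * Real.pi), evolution H t ∈ circuits HZ HX) :
      H ∈ observables (lieAlgebraOf K hK) := by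
    -- Evolution is `exp (-i t H)`, so nonnegative times belong to the generator `-i H`.
    rw [mem_observables, ← neg_mem_iff]
    refine mem_lieAlgebraOf_of_Icc hK hKu (skewAdjoint.mem_iff.2 ?_) Real.two_pi_pos
      fun t ht => hle (circuits_subset_phasedCircuits ?_)
    · rw [star_neg, star_smul, Matrix.star_eq_conjTranspose, hH.eq]
      simp
    · convert hc t ht using 1
      rw [evolution, ← Complex.coe_smul t, smul_neg, smul_smul, neg_smul, mul_comm]
  -- The identity circuit with an arbitrary phase gives the one-parameter group of `i 1`.
  have hone : (1 : Op V) ∈ observables (lieAlgebraOf K hK) := by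
    refine ⟨skewAdjoint.mem_iff.2 (by simp [star_smul]), fun t => hle ⟨1, ?_, t, ?_⟩⟩
    · simpa [evolution_zero] using evolution_mul_mem_circuits (HZ := HZ) (HX := HX)
        zero_mem_Icc_two_pi zero_mem_Icc_two_pi
    · rw [← Complex.coe_smul t, smul_smul, mul_comm, Complex.exp_eq_exp_ℂ,
        ← Algebra.algebraMap_eq_smul_one, ← Algebra.algebraMap_eq_smul_one,
        NormedSpace.algebraMap_exp_comm]
  have hall := h (lieAlgebraOf K hK)
    (hgen HZ hZ fun t ht => by
      simpa [evolution_zero] using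
        evolution_mul_mem_circuits (HZ := HZ) (HX := HX) zero_mem_Icc_two_pi ht)
    (hgen HX hX fun t ht => by
      simpa [evolution_zero] using
        evolution_mul_mem_circuits (HZ := HZ) (HX := HX) ht zero_mem_Icc_two_pi) hone
  intro U hU ε hε
  obtain ⟨a, ha, rfl⟩ := exists_exp_eq_of_finite_spectrum hU (finite_spectrum_matrix U)
  have hmem : NormedSpace.exp (Complex.I • a) ∈ K := by
    simpa using ((mem_lieAlgebraOf (hK := hK)).1 (hall a ha)).2 1
  obtain ⟨_, ⟨W, hW, θ, rfl⟩, hdist⟩ := Metric.mem_closure_iff.1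
    (show NormedSpace.exp (Complex.I • a) ∈ closure (phasedCircuits HZ HX : Set (Op V)) from hmem)
    ε hε
  refine ⟨W, hW, θ, ?_⟩
  rw [dist_eq_norm, Matrix.cstar_norm_def] at hdist
  exact hdist.le

end Universality

end QAOA

theorem mainTheorem3 {V : Type*} [Fintype V] [DecidableEq V] (G : SimpleGraph V)
    [DecidableRel G.Adj] (S : Finset V) (γ : ℝ) (ωS : S → ℝ) (ω : ℝ)
    (hindep : LinearIndependent ℚ (Sum.elim ![γ, ω] ωS : Fin 2 ⊕ S → ℝ))
    (hS : QAOA.IsZeroForcingSet G S) :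
    (∀ k j : V, G.Adj k j →
      Complex.I • (QAOA.Z k * QAOA.Z j) ∈
        QAOA.generatedLieAlgebra (QAOA.costHamiltonian G S γ ωS ω) (QAOA.mixerHamiltonian V)) ∧
    (∀ k : V,
      Complex.I • QAOA.X k ∈
        QAOA.generatedLieAlgebra (QAOA.costHamiltonian G S γ ωS ω) (QAOA.mixerHamiltonian V)) ∧
    (G.Connected →
      QAOA.IsUniversal (QAOA.costHamiltonian G S γ ωS ω) (QAOA.mixerHamiltonian V)) := by
  -- `L` stays arbitrary because it serves twice: as the generated Lie algebra, and in the
  -- universality criterion, where `L` also contains `i 1`.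
  have hXZ (L : LieSubalgebra ℝ (QAOA.Op V))
      (hZ : QAOA.costHamiltonian G S γ ωS ω ∈ QAOA.observables L)
      (hX : QAOA.mixerHamiltonian V ∈ QAOA.observables L) (v : V) :=
    QAOA.X_Z_mem_of_isZeroForcingSet hZ hX hindep hS v
  have hZZ (L : LieSubalgebra ℝ (QAOA.Op V))
      (hZ : QAOA.costHamiltonian G S γ ωS ω ∈ QAOA.observables L)
      (hX : QAOA.mixerHamiltonian V ∈ QAOA.observables L) (k j : V) (hkj : G.Adj k j) :
      QAOA.Z k * QAOA.Z j ∈ QAOA.observables L :=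
    QAOA.Z_mul_Z_mem (QAOA.sum_edgeZZ_mem hZ hX hindep) (hXZ L hZ hX k).1 (hXZ L hZ hX j).1 hkj
  have hgZ : QAOA.costHamiltonian G S γ ωS ω ∈ QAOA.observables
      (QAOA.generatedLieAlgebra (QAOA.costHamiltonian G S γ ωS ω) (QAOA.mixerHamiltonian V)) :=
    LieSubalgebra.subset_lieSpan (by simp)
  have hgX : QAOA.mixerHamiltonian V ∈ QAOA.observables
      (QAOA.generatedLieAlgebra (QAOA.costHamiltonian G S γ ωS ω) (QAOA.mixerHamiltonian V)) :=
    LieSubalgebra.subset_lieSpan (by simp)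
  refine ⟨hZZ _ hgZ hgX, fun k => (hXZ _ hgZ hgX k).1, fun hG => ?_⟩
  refine QAOA.isUniversal_of_observables ?_ ?_ fun L hZ hX h1 A hA =>
    QAOA.isHermitian_mem_of_connected (hXZ L hZ hX) (hZZ L hZ hX) hG h1 hA
  · rw [QAOA.costHamiltonian_eq_diagonal]
    exact Matrix.isHermitian_diagonal_of_self_adjoint _ (funext fun a => Complex.conj_ofReal _)
  · exact isSelfAdjoint_sum _ fun i _ => QAOA.onQubit_isHermitian i (QAOA.pauli_isHermitian 0)
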